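/- Let $\mathbb E$ be a space of absolute geometry, that is, a set of points with distinguished families of subsets called straight lines and planes, a ternary relation "$B$ lies between $A$ and $C$" on triples of distinct collinear points, and two binary relations $\cong$, congruence of segments and congruence of angles, satisfying axioms (I)–(IV) below. For $A\ne B$ the segment $[AB]$ is the set consisting of $A$, $B$ and all points between $A$ and $B$ (the latter form its interior). The ray $[OE\rangle$, $O\neq E$, consists of $O$, of $E$, of the points between $O$ and $E$, and of the points $X$ such that $E$ is between $O$ and $X$. A line $a$ lying in a plane splits the rest of the plane into two open half-planes, two points being in the same one iff they coincide or the segment joining them does not meet $a$; a closed half-plane is an open one together with $a$. For $A,O,B$ not on one line, the angle $\angle AOB$ is the intersection of the closed half-plane bounded by the line $OA$ that contains $B$ with the closed half-plane bounded by $OB$ that contains $A$. (I) Incidence. Each line contains at least two points; through two distinct points passes exactly one line; there are three points not on one line; through three points not on one line passes exactly one plane; each plane contains a point; a line having two distinct points in a plane lies in that plane; two intersecting planes have at least two common points; there are four points not on one plane. (II) Order. If $B$ is between $A$ and $C$, it is between $C$ and $A$; for distinct $A,B$ there is $C$ such that $B$ is between $A$ and $C$; of three points at most one is between the other two; (Pasch)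 if $A,B,C$ are points of a plane not on one line, and a line $a$ of this plane contains none of them and meets the interior of $[AB]$, then it meets the interior of $[AC]$ or of $[BC]$. (III) Congruence. Each segment is congruent to itself, and for each segment $[AB]$ and each ray beginning at a point $C$ there is a unique point $D$ on the ray with $[AB]\cong[CD]$; congruence of segments is transitive; if $B$ is between $A$ and $C$, $L$ is between $K$ and $M$, and $[AB]\cong[KL]$, then $[BC]\cong[LM]$ implies $[AC]\cong[KM]$, and $[AC]\cong[KM]$ implies $[BC]\cong[LM]$; each angle is congruent to itself, and for each angle $\theta$, each half-plane and each ray $m$ on its boundary line there is a unique ray $n$ in the half-plane, with the same beginning as $m$ and not on the boundary line, such that $\theta$ is congruent to the angle formed by $m$ and $n$; if $A,B,C$ are not on one line, $A',B',C'$ are not on one line, $[AB]\cong[A'B']$, $[AC]\cong[A'C']$ and $\angle BAC\cong\angle B'A'C'$, then $\angle ABC\cong\angle A'B'C'$ and $\angle ACB\cong\angle A'C'B'$. (IV) Continuity. (Archimedes) For any segments $[AB]$, $[OE]$ there are a positive integer $n$ and a segment $[CD]$ that is a sum of $n$ replicas of $[OE]$ (that is, there are points $C=A_0,A_1,\dots,A_n=D$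 with $[A_{i-1}A_i]\cong[OE]$ for $1\le i\le n$ and $A_i$ between $A_{i-1}$ and $A_{i+1}$ for $0<i<n$) such that $[AB]$ is smaller than $[CD]$, i.e. $[AB]\cong[CX]$ for some $X$ in the interior of $[CD]$. (Cantor) If $[A_1B_1]\supset[A_2B_2]\supset\cdots$ are segments on one line, they have a common point. No axiom of parallels is assumed. **Theorem 7.4.** Let $[OE]$ be a fixed reference segment, where $O\neq E$. There is exactly one function $\xi$ assigning to each segment $[PQ]$ of $\mathbb E$ a positive real number $\xi([PQ])$ such that 1. $\xi([OE])=1$; 2. $[AB]\cong[CD]$ implies $\xi([AB])=\xi([CD])$; 3. if a point $B$ lies in the interior of a segment $[AC]$, then $\xi([AC])=\xi([AB])+\xi([BC])$. -/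

import Mathlib

universe u

/-- A space of points `P` with its straight lines and planes (certain sets of points) and the
ternary relation `Between A B C` (the point `B` lies between `A` and `C`), satisfying the axioms of
incidence and the axioms of order. -/
class OrderedGeometry (P : Type u) where
  /-- the straight lines -/
  lines : Set (Set P)
  /-- the planes -/
  planes : Set (Set P)
  /-- `Between A B C`: the point `B` lies between `A` and `C` -/
  Between : P → P → P → Prop
  /-- Each straight line contains at least two points. -/
  line_two_points : ∀ a ∈ lines, ∃ A ∈ a, ∃ B ∈ a, A ≠ B
  /-- Through two distinct points there passes exactly one straight line. -/
  existsUnique_line : ∀ A B : P, A ≠ B → ∃! a : Set P, a ∈ lines ∧ A ∈ a ∧ B ∈ a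
  /-- There are at least three points which do not lie on one straight line. -/
  three_points : ∃ A B C : P, A ≠ B ∧ A ≠ C ∧ B ≠ C ∧
    ¬ ∃ a ∈ lines, A ∈ a ∧ B ∈ a ∧ C ∈ a
  /-- Through three points not on one straight line there passes exactly one plane. -/
  existsUnique_plane : ∀ A B C : P, (¬ ∃ a ∈ lines, A ∈ a ∧ B ∈ a ∧ C ∈ a) →
    ∃! α : Set P, α ∈ planes ∧ A ∈ α ∧ B ∈ α ∧ C ∈ α
  /-- Each plane contains at least one point. -/
  plane_nonempty : ∀ α ∈ planes, α.Nonempty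
  /-- If two distinct points of a line lie on a plane, the whole line lies on that plane. -/
  line_subset_plane : ∀ a ∈ lines, ∀ α ∈ planes, ∀ A B : P, A ≠ B →
    A ∈ a → B ∈ a → A ∈ α → B ∈ α → a ⊆ α
  /-- If two planes intersect, their intersection contains at least two points. -/
  planes_inter : ∀ α ∈ planes, ∀ β ∈ planes, (α ∩ β).Nonempty →
    ∃ A ∈ α ∩ β, ∃ B ∈ α ∩ β, A ≠ B
  /-- There are at least four points which do not lie on one plane. -/
  four_points : ∃ A B C D : P, A ≠ B ∧ A ≠ C ∧ A ≠ D ∧ B ≠ C ∧ B ≠ D ∧ C ≠ D ∧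
    ¬ ∃ α ∈ planes, A ∈ α ∧ B ∈ α ∧ C ∈ α ∧ D ∈ α
  /-- Betweenness is a relation among three distinct points ... -/
  between_ne : ∀ A B C : P, Between A B C → A ≠ B ∧ B ≠ C ∧ A ≠ C
  /-- ... lying on one straight line. -/
  between_collinear : ∀ A B C : P, Between A B C → ∃ a ∈ lines, A ∈ a ∧ B ∈ a ∧ C ∈ a
  /-- If `B` lies between `A` and `C`, then it lies between `C` and `A`. -/
  between_symm : ∀ A B C : P, Between A B C → Between C B A
  /-- For any distinct `A` and `B` there is a point `C` such that `B` lies between `A` and `C`. -/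
  between_extend : ∀ A B : P, A ≠ B → ∃ C : P, Between A B C
  /-- At most one of three points lies between the two others. -/
  between_unique : ∀ A B C : P, Between A B C → ¬ Between B C A ∧ ¬ Between C A B
  /-- Pasch's axiom. -/
  pasch : ∀ α ∈ planes, ∀ A ∈ α, ∀ B ∈ α, ∀ C ∈ α,
    (¬ ∃ b ∈ lines, A ∈ b ∧ B ∈ b ∧ C ∈ b) →
    ∀ a ∈ lines, a ⊆ α → A ∉ a → B ∉ a → C ∉ a →
    (∃ X ∈ a, Between A X B) → (∃ X ∈ a, Between A X C) ∨ (∃ X ∈ a, Between B X C)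

namespace OrderedGeometry

variable {P : Type u} [OrderedGeometry P]

/-- The three points `A`, `B`, `C` lie on one straight line. -/
def OnOneLine (A B C : P) : Prop := ∃ a ∈ lines (P := P), A ∈ a ∧ B ∈ a ∧ C ∈ a

/-- The straight line `AB` (for distinct `A` and `B` there is only one line `a` in the union). -/
def line (A B : P) : Set P := {X | ∃ a ∈ lines (P := P), A ∈ a ∧ B ∈ a ∧ X ∈ a}

/-- The open interval `(AB)`, the interior of the segment `[AB]`. -/
def interval (A B : P) : Set P := {X | Between A X B}

/-- The set `[AB]`: the open interval together with its ending points. -/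
def segmentSet (A B : P) : Set P := {A} ∪ {B} ∪ interval A B

/-- The ray `[OE⟩` that begins at `O` and passes through `E`. -/
def ray (O E : P) : Set P := {X | X = O ∨ X = E ∨ Between O X E ∨ Between O E X}

/-- For a line `a` and a point `B` outside of it: the open half-plane, bounded by `a` in the plane
through `a` and `B`, that contains `B`. It consists of the points `X` of this plane, not on `a`,
which either coincide with `B` or for which the segment `[XB]` has no common points with `a`. -/
def openHalfPlane (a : Set P) (B : P) : Set P :=
  {X | X ∉ a ∧ (∃ α ∈ planes (P := P), a ⊆ α ∧ B ∈ α ∧ X ∈ α) ∧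
    (X = B ∨ Disjoint (segmentSet X B) a)}

/-- The closed half-plane. -/
def closedHalfPlane (a : Set P) (B : P) : Set P := openHalfPlane a B ∪ a

/-- The angle `∠AOB`, for `A`, `O`, `B` not on one line: the intersection of the closed half-plane
bounded by the line `OA` that contains `B` and the closed half-plane bounded by `OB` that
contains `A`. -/
def angleSet (A O B : P) : Set P := closedHalfPlane (line O A) B ∩ closedHalfPlane (line O B) A

end OrderedGeometry

open OrderedGeometry

/-- The straight line segments of the space: the sets `[AB]` with `A ≠ B`. -/
def Segment (P : Type u) [OrderedGeometry P] : Type u :=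
  {s : Set P // ∃ A B : P, A ≠ B ∧ s = segmentSet A B}

/-- The segment `[AB]`; note that `[AB] = [BA]`. -/
def Segment.of {P : Type u} [OrderedGeometry P] (A B : P) (h : A ≠ B) : Segment P :=
  ⟨segmentSet A B, A, B, h, rfl⟩

/-- The angles of the space: the sets `∠AOB` with `A`, `O`, `B` not on one straight line. -/
def PlaneAngle (P : Type u) [OrderedGeometry P] : Type u :=
  {s : Set P // ∃ A O B : P, ¬ OnOneLine A O B ∧ s = angleSet A O B}

/-- The angle `∠AOB`. -/
def PlaneAngle.of {P : Type u} [OrderedGeometry P] (A O B : P) (h : ¬ OnOneLine A O B) :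
    PlaneAngle P :=
  ⟨angleSet A O B, A, O, B, h, rfl⟩

/-- A space with the axioms of incidence and order which is equipped with two binary relations,
congruence of segments and congruence of angles, satisfying the axioms of congruence. -/
class CongruenceGeometry (P : Type u) extends OrderedGeometry P where
  /-- congruence of segments -/
  SegCong : Segment P → Segment P → Prop
  /-- congruence of angles -/
  AngCong : PlaneAngle P → PlaneAngle P → Prop
  /-- Any segment is congruent to itself. -/
  segCong_refl : ∀ s : Segment P, SegCong s s
  /-- On any ray `[CE⟩` there is a unique point `D` such that the given segment is congruent
  to `[CD]`. -/
  segment_transfer : ∀ (s : Segment P) (C E : P), C ≠ E →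
    ∃! D : P, D ∈ ray C E ∧ ∃ h : C ≠ D, SegCong s (Segment.of C D h)
  /-- Congruence of segments is transitive. -/
  segCong_trans : ∀ s t r : Segment P, SegCong s t → SegCong t r → SegCong s r
  /-- Segments composed of congruent segments are congruent. -/
  segment_sum : ∀ (A B C K L M : P) (h : Between A B C) (h' : Between K L M),
    SegCong (Segment.of A B (between_ne A B C h).1) (Segment.of K L (between_ne K L M h').1) →
    SegCong (Segment.of B C (between_ne A B C h).2.1) (Segment.of L M (between_ne K L M h').2.1) →
    SegCong (Segment.of A C (between_ne A B C h).2.2) (Segment.of K M (between_ne K L M h').2.2)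
  /-- Differences of congruent segments are congruent. -/
  segment_difference : ∀ (A B C K L M : P) (h : Between A B C) (h' : Between K L M),
    SegCong (Segment.of A B (between_ne A B C h).1) (Segment.of K L (between_ne K L M h').1) →
    SegCong (Segment.of A C (between_ne A B C h).2.2) (Segment.of K M (between_ne K L M h').2.2) →
    SegCong (Segment.of B C (between_ne A B C h).2.1) (Segment.of L M (between_ne K L M h').2.1)
  /-- Any angle is congruent to itself. -/
  angCong_refl : ∀ θ : PlaneAngle P, AngCong θ θ
  /-- For the half-plane bounded by the line `OA` that contains `B` and for the ray `[OA⟩` on its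
  boundary there is a unique ray `n = [OC⟩` within this half-plane such that the given angle is
  congruent to the angle formed by `[OA⟩` and `n`. -/
  angle_transfer : ∀ (θ : PlaneAngle P) (O A B : P), ¬ OnOneLine A O B →
    ∃! n : Set P, ∃ C ∈ openHalfPlane (line O A) B, n = ray O C ∧
      ∃ h : ¬ OnOneLine A O C, AngCong θ (PlaneAngle.of A O C h)
  /-- The congruence of two sides and of the angle between them in two triangles implies the
  congruence of the other two angles. -/
  side_angle_side : ∀ (A B C A' B' C' : P)
    (hAB : A ≠ B) (hAC : A ≠ C) (hAB' : A' ≠ B') (hAC' : A' ≠ C')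
    (hA : ¬ OnOneLine B A C) (hB : ¬ OnOneLine A B C) (hC : ¬ OnOneLine A C B)
    (hA' : ¬ OnOneLine B' A' C') (hB' : ¬ OnOneLine A' B' C') (hC' : ¬ OnOneLine A' C' B'),
    SegCong (Segment.of A B hAB) (Segment.of A' B' hAB') →
    SegCong (Segment.of A C hAC) (Segment.of A' C' hAC') →
    AngCong (PlaneAngle.of B A C hA) (PlaneAngle.of B' A' C' hA') →
    AngCong (PlaneAngle.of A B C hB) (PlaneAngle.of A' B' C' hB') ∧
      AngCong (PlaneAngle.of A C B hC) (PlaneAngle.of A' C' B' hC')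

open CongruenceGeometry

/-- The segment `s` is smaller than the segment `t`: `t = [CD]` and there is a point `E` in the
interior of `[CD]` such that `s` is congruent to `[CE]`. -/
def Segment.Smaller {P : Type u} [CongruenceGeometry P] (s t : Segment P) : Prop :=
  ∃ (C D E : P) (h : Between C E D), t = Segment.of C D (between_ne C E D h).2.2 ∧
    SegCong s (Segment.of C E (between_ne C E D h).1)

/-- The segment `t` is the sum of `n` replicas of the segment `e`: its ending points are joined by
a monotonic sequence of points `A 0, A 1, …, A n` on a line (each inner point lies between its two
neighbours) such that the segments `[A i, A (i+1)]` are congruent to `e`. -/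
def Segment.IsSumOfReplicas {P : Type u} [CongruenceGeometry P]
    (t : Segment P) (n : ℕ) (e : Segment P) : Prop :=
  ∃ A : ℕ → P, (∃ h : A 0 ≠ A n, t = Segment.of (A 0) (A n) h) ∧
    (∀ i, i + 1 ≤ n → ∃ h : A i ≠ A (i + 1), SegCong e (Segment.of (A i) (A (i + 1)) h)) ∧
    (∀ i, i + 2 ≤ n → Between (A i) (A (i + 1)) (A (i + 2)))

/-- The space of absolute geometry: the axioms of incidence, order and congruence together with the
two axioms of continuity. No axiom of parallels is assumed. -/
class AbsoluteGeometry (P : Type u) extends CongruenceGeometry P where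
  /-- The Archimedes axiom: each segment is smaller than some sum of replicas of another one. -/
  archimedes : ∀ s e : Segment P, ∃ n : ℕ, 0 < n ∧
    ∃ t : Segment P, Segment.IsSumOfReplicas t n e ∧ Segment.Smaller s t
  /-- Cantor's axiom: a decreasing sequence of segments on a line has a common point. -/
  cantor : ∀ a ∈ OrderedGeometry.lines (P := P), ∀ s : ℕ → Segment P,
    (∀ n, (s n).1 ⊆ a) → (∀ n, (s (n + 1)).1 ⊆ (s n).1) → ∃ X : P, ∀ n, X ∈ (s n).1

/-- `ξ` is a length function on the segments of the space with the reference segment `e`. -/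
structure IsLengthFunction {P : Type u} [CongruenceGeometry P]
    (e : Segment P) (ξ : Segment P → ℝ) : Prop where
  /-- lengths are positive numbers -/
  pos : ∀ s : Segment P, 0 < ξ s
  /-- the reference segment has length one -/
  reference : ξ e = 1
  /-- congruent segments have equal lengths -/
  congruent : ∀ s t : Segment P, SegCong s t → ξ s = ξ t
  /-- additivity, when an interior point `B` splits the segment `[AC]` -/
  additive : ∀ (A B C : P) (h : Between A B C),
    ξ (Segment.of A C (between_ne A B C h).2.2) =
      ξ (Segment.of A B (between_ne A B C h).1) + ξ (Segment.of B C (between_ne A B C h).2.1)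

/-! Length is additive measurement on the semigroup of congruence classes of segments. Laying
segments end to end defines a sum of classes: the congruence axioms make it well defined, reversing
a segment gives commutativity, and associativity is a statement about the order of four points on a
line. Laying two segments off on one ray gives comparability (`segmentClass_total`), the uniqueness
of transfer gives `segmentClass_add_ne`, and the Archimedes axiom carries over as
`segmentClass_archimedean`.

With a zero adjoined, the classes form an archimedean ordered monoid, which embeds in the reals by
Hölder's theorem; this is existence (`exists_real_measure`). Uniqueness (`real_measure_unique`)
holds because a rational strictly between two values of the same class would make a multiple of that
class both smaller and greater than a multiple of the unit.

The geometric labour is to derive the linear order of points from Pasch's axiom, mainly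
`between_of_not_between`, `Between.trans_right` and `Between.inner_left`. -/

/-! ### Real measures on archimedean positive semigroups -/

/-- The order of a totally ordered, cancellative commutative monoid without negative elements,
given by divisibility: `a ≤ b` if `a + c = b` for some `c`. -/
noncomputable abbrev divisibilityOrder {T : Type*} [AddCommMonoid T]
    (total : ∀ a b : T, ∃ c, a + c = b ∨ b + c = a)
    (cancel : ∀ a c : T, a + c = a → c = 0) (zero_sum : ∀ a b : T, a + b = 0 → a = 0) :
    LinearOrder T where
  le a b := ∃ c, a + c = b
  le_refl a := ⟨0, add_zero a⟩
  le_trans := by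
    rintro a _ _ ⟨c, rfl⟩ ⟨d, rfl⟩
    exact ⟨c + d, (add_assoc _ _ _).symm⟩
  le_antisymm := by
    rintro a _ ⟨c, rfl⟩ ⟨d, h⟩
    rw [zero_sum c d (cancel a _ (by rwa [← add_assoc])), add_zero]
  le_total a b := by
    obtain ⟨c, h | h⟩ := total a b
    · exact .inl ⟨c, h⟩
    · exact .inr ⟨c, h⟩
  toDecidableLE := Classical.decRel _

open Algebra in
/-- Hölder's theorem for positive cones: an archimedean canonically ordered cancellative monoid
embeds into the real numbers. -/
theorem exists_addMonoidHom_real {T : Type*} [AddCommMonoid T] [LinearOrder T]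
    [IsOrderedCancelAddMonoid T] [CanonicallyOrderedAdd T] [Archimedean T] {e : T} (he : 0 < e) :
    ∃ f : T →+ ℝ, StrictMono f ∧ f e = 1 := by
  let G := GrothendieckAddGroup T
  let i : T →+ G := GrothendieckAddGroup.of
  have hi (a : T) : i a = AddLocalization.mk a 0 :=
    (AddLocalization.mk_zero_eq_addMonoidOf_mk a).symm
  have hlt : StrictMono i := fun a b h => by
    rw [hi, hi, AddLocalization.mk_lt_mk]
    simpa using h
  have hGe : 0 < i e := by simpa using hlt he
  have harch : Archimedean G := ⟨fun x y hy => by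
    induction x using AddLocalization.ind with
    | _ x =>
    induction y using AddLocalization.ind with
    | _ y =>
    obtain ⟨a, b⟩ := x
    obtain ⟨c, d⟩ := y
    have hdc : (d : T) < c := by
      rw [← AddLocalization.mk_zero, AddLocalization.mk_lt_mk] at hy
      simpa using hy
    -- Now `y = c - d` is the image of `k`, and a multiple of `k` above `a` also bounds `x = a - b`.
    obtain ⟨k, rfl⟩ := exists_add_of_le hdc.le
    have hk : 0 < k := by simpa using hdc
    obtain ⟨n, hn⟩ := Archimedean.arch a hk
    refine ⟨n, ?_⟩
    have h1 : AddLocalization.mk ((d : T) + k) d = i k := by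
      rw [hi, AddLocalization.mk_eq_mk_iff, AddLocalization.r_iff_exists]
      exact ⟨0, by simp⟩
    rw [h1, ← map_nsmul, hi, AddLocalization.mk_le_mk]
    simpa using hn.trans (self_le_add_left _ _)⟩
  -- The embedding of an archimedean group sends its distinguished `1` to the real `1`, so choosing
  -- `1` as the image of `e` normalises it.
  let one : One G := ⟨i e⟩
  have : ZeroLEOneClass G := ⟨hGe.le⟩
  have : NeZero (1 : G) := ⟨hGe.ne'⟩
  refine ⟨(Archimedean.embedReal G : G →+ ℝ).comp i, ?_, ?_⟩
  · exact (Archimedean.embedRealFun_strictMono G).comp hlt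
  · exact Archimedean.embedReal_one (M := G)

/-- Measurement of the elements of an archimedean positive semigroup by real numbers. -/
theorem exists_real_measure {M : Type*} [AddCommSemigroup M]
    (total : ∀ a b : M, a = b ∨ (∃ c, a + c = b) ∨ ∃ c, b + c = a)
    (add_ne : ∀ a c : M, a + c ≠ a)
    (arch : ∀ a e : M, ∃ n : ℕ, ∃ c : WithZero M, (a : WithZero M) + c = n • (e : WithZero M))
    (e : M) :
    ∃ f : M → ℝ, (∀ a, 0 < f a) ∧ f e = 1 ∧ ∀ a b, f (a + b) = f a + f b := by
  have cancel : ∀ a c : WithZero M, a + c = a → c = 0 := by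
    intro a c h
    induction a with
    | zero => rwa [zero_add] at h
    | coe a =>
      induction c with
      | zero => rfl
      | coe c => exact absurd (by exact_mod_cast h) (add_ne a c)
  have zero_sum : ∀ a b : WithZero M, a + b = 0 → a = 0 := by
    intro a b h
    induction a with
    | zero => rfl
    | coe a =>
      induction b with
      | zero => simp at h
      | coe b => exact absurd (by exact_mod_cast h) (WithZero.coe_ne_zero (a := a + b))
  have total' : ∀ a b : WithZero M, ∃ c, a + c = b ∨ b + c = a := by
    intro a b
    induction a with
    | zero => exact ⟨b, .inl (zero_add b)⟩
    | coe a =>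
      induction b with
      | zero => exact ⟨a, .inr (zero_add _)⟩
      | coe b =>
        obtain rfl | ⟨c, rfl⟩ | ⟨c, rfl⟩ := total a b
        · exact ⟨0, .inl (add_zero _)⟩
        · exact ⟨c, .inl (by norm_cast)⟩
        · exact ⟨c, .inr (by norm_cast)⟩
  let _ : LinearOrder (WithZero M) := divisibilityOrder total' cancel zero_sum
  have : IsOrderedCancelAddMonoid (WithZero M) :=
    { add_le_add_left := by
        rintro a _ ⟨c, rfl⟩ b
        exact ⟨c, by abel⟩
      le_of_add_le_add_left := by
        rintro a b c ⟨d, hd⟩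
        obtain ⟨x, rfl | rfl⟩ := total' b c
        · exact ⟨x, rfl⟩
        · have h0 : x + d = 0 := cancel (a + c) _ (by simpa only [add_assoc] using hd)
          exact ⟨0, by simp [zero_sum x d h0]⟩ }
  have : CanonicallyOrderedAdd (WithZero M) :=
    { exists_add_of_le := by
        rintro a _ ⟨c, rfl⟩
        exact ⟨c, rfl⟩
      le_add_self := fun a b => ⟨b, add_comm _ _⟩
      le_self_add := fun a b => ⟨b, rfl⟩ }
  have pos (a : M) : 0 < (a : WithZero M) := pos_of_ne_zero WithZero.coe_ne_zero
  have : Archimedean (WithZero M) := ⟨fun x y hy => by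
    induction x with
    | zero => exact ⟨0, by simp⟩
    | coe a =>
      induction y with
      | zero => exact absurd hy (lt_irrefl _)
      | coe e => exact arch a e⟩
  obtain ⟨f, hf, he⟩ := exists_addMonoidHom_real (pos e)
  refine ⟨fun a => f a, fun a => ?_, he, fun a b => ?_⟩
  · simpa using hf (pos a)
  · exact (congrArg f (WithZero.coe_add a b)).trans (map_add f _ _)

/-- A real measure of the elements of a positive semigroup is determined by its unit. -/
theorem real_measure_unique {M : Type*} [AddCommSemigroup M]
    (total : ∀ a b : M, a = b ∨ (∃ c, a + c = b) ∨ ∃ c, b + c = a) {e : M} {f g : M → ℝ}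
    (hf : ∀ a, 0 < f a) (hfe : f e = 1) (hfa : ∀ a b, f (a + b) = f a + f b)
    (hg : ∀ a, 0 < g a) (hge : g e = 1) (hga : ∀ a b, g (a + b) = g a + g b) : f = g := by
  suffices key : ∀ {f g : M → ℝ}, (∀ a, 0 < f a) → f e = 1 → (∀ a b, f (a + b) = f a + f b) →
      (∀ a, 0 < g a) → g e = 1 → (∀ a b, g (a + b) = g a + g b) → ∀ a, ¬ f a < g a by
    funext a
    exact le_antisymm (not_lt.1 (key hg hge hga hf hfe hfa a))
      (not_lt.1 (key hf hfe hfa hg hge hga a))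
  intro f g hf hfe hfa hg hge hga a hlt
  -- The multiple is `n + 1` because the semigroup has no zero; `b` must serve `f` and `g`
  -- simultaneously.
  have mult (n : ℕ) (a : M) : ∃ b : M, ∀ h : M → ℝ, (∀ a b, h (a + b) = h a + h b) →
      h b = (n + 1) * h a := by
    induction n with
    | zero => exact ⟨a, fun h _ => by simp⟩
    | succ n ih =>
      obtain ⟨b, hb⟩ := ih
      refine ⟨b + a, fun h hh => ?_⟩
      rw [hh, hb h hh]
      push_cast
      ring
  obtain ⟨q, hq1, hq2⟩ := exists_rat_btwn hlt
  have hq : 0 < q := by exact_mod_cast (hf a).trans hq1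
  obtain ⟨n, hn⟩ := Nat.exists_eq_succ_of_ne_zero q.den_ne_zero
  obtain ⟨m, hm⟩ := Int.eq_succ_of_zero_lt (Rat.num_pos.2 hq)
  have hqn : (q : ℝ) * (n + 1) = m + 1 := by
    have h1 : (q * q.den : ℚ) = q.num := Rat.mul_den_eq_num q
    rw [hn, hm] at h1
    exact_mod_cast h1
  obtain ⟨x, hx⟩ := mult n a
  obtain ⟨y, hy⟩ := mult m e
  have hn0 : (0 : ℝ) < n + 1 := by positivity
  have h1 : f x < f y := by
    rw [hx f hfa, hy f hfa, hfe]
    nlinarith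
  have h2 : g y < g x := by
    rw [hx g hga, hy g hga, hge]
    nlinarith
  -- By the choice of `q`, `f` orders `x = (n+1)a` before `y = (m+1)e` and `g` orders them the other
  -- way, but positive additive functions must agree with the comparison in `M`.
  obtain rfl | ⟨c, rfl⟩ | ⟨c, rfl⟩ := total x y
  · exact lt_irrefl _ h1
  · linarith [hga x c, hg c]
  · linarith [hfa y c, hf c]

/-! ### Incidence and Pasch's axiom -/

namespace OrderedGeometry

variable {P : Type u} [OrderedGeometry P] {A B C D E G X Y Z : P} {a b : Set P}

theorem line_unique (hab : A ≠ B) (ha : a ∈ lines) (hb : b ∈ lines)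
    (h1 : A ∈ a) (h2 : B ∈ a) (h3 : A ∈ b) (h4 : B ∈ b) : a = b :=
  (existsUnique_line A B hab).unique ⟨ha, h1, h2⟩ ⟨hb, h3, h4⟩

theorem exists_line (A B : P) (h : A ≠ B) : ∃ a ∈ lines (P := P), A ∈ a ∧ B ∈ a := by
  obtain ⟨a, ⟨h1, h2, h3⟩, -⟩ := existsUnique_line A B h
  exact ⟨a, h1, h2, h3⟩

theorem Between.symm (h : Between A B C) : Between C B A := between_symm A B C h

theorem Between.ne₁₂ (h : Between A B C) : A ≠ B := (between_ne A B C h).1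

theorem Between.ne₂₃ (h : Between A B C) : B ≠ C := (between_ne A B C h).2.1

theorem Between.ne₁₃ (h : Between A B C) : A ≠ C := (between_ne A B C h).2.2

theorem Between.not_rotate (h : Between A B C) : ¬ Between B C A := (between_unique A B C h).1

theorem Between.not_rotate' (h : Between A B C) : ¬ Between C A B := (between_unique A B C h).2

/-- A line through the outer points passes through the inner one. -/
theorem Between.mem₂ (h : Between A B C) (ha : a ∈ lines) (h1 : A ∈ a) (h2 : C ∈ a) : B ∈ a := by
  obtain ⟨b, hb, hA, hB, hC⟩ := between_collinear A B C h
  rwa [line_unique h.ne₁₃ ha hb h1 h2 hA hC]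

theorem Between.mem₃ (h : Between A B C) (ha : a ∈ lines) (h1 : A ∈ a) (h2 : B ∈ a) : C ∈ a := by
  obtain ⟨b, hb, hA, hB, hC⟩ := between_collinear A B C h
  rwa [line_unique h.ne₁₂ ha hb h1 h2 hA hB]

theorem Between.mem₁ (h : Between A B C) (ha : a ∈ lines) (h1 : B ∈ a) (h2 : C ∈ a) : A ∈ a :=
  h.symm.mem₃ ha h2 h1

/-- Two different lines have at most one common point. -/
theorem eq_of_mem_lines (ha : a ∈ lines) (hb : b ∈ lines) (hD : D ∈ a) (hDb : D ∉ b)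
    (h1 : X ∈ a) (h2 : X ∈ b) (h3 : Y ∈ a) (h4 : Y ∈ b) : X = Y := by
  by_contra hne
  exact hDb (line_unique hne ha hb h1 h3 h2 h4 ▸ hD)

theorem exists_notMem (ha : a ∈ lines (P := P)) : ∃ X, X ∉ a := by
  obtain ⟨A, B, C, -, -, -, h⟩ := three_points (P := P)
  by_contra! hc
  exact h ⟨a, ha, hc A, hc B, hc C⟩

/-- Pasch's axiom for a line through a point `X` of the interior of `[AB]` and another point `Y` of
the line `BC`. -/
theorem pasch_of_mem_side (hb : b ∈ lines) (hB : B ∈ b) (hC : C ∈ b) (hYb : Y ∈ b) (hAb : A ∉ b)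
    (hBC : B ≠ C) (hX : Between A X B) (ha : a ∈ lines) (hXa : X ∈ a) (hYa : Y ∈ a)
    (hA : A ∉ a) (hBa : B ∉ a) (hCa : C ∉ a) :
    (∃ Z ∈ a, Between A Z C) ∨ ∃ Z ∈ a, Between B Z C := by
  have hn : ¬ OnOneLine A B C := by
    rintro ⟨c, hc, h1, h2, h3⟩
    exact hAb (line_unique hBC hb hc hB hC h2 h3 ▸ h1)
  obtain ⟨α, ⟨hα, hAα, hBα, hCα⟩, -⟩ := existsUnique_plane A B C hn
  have hXY : X ≠ Y := by
    rintro rfl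
    exact hAb (hX.mem₁ hb hYb hB)
  have hXα : X ∈ α := by
    obtain ⟨c, hc, h1, h2⟩ := exists_line A B hX.ne₁₃
    exact line_subset_plane c hc α hα A B hX.ne₁₃ h1 h2 hAα hBα (hX.mem₂ hc h1 h2)
  have hYα : Y ∈ α := line_subset_plane b hb α hα B C hBC hB hC hBα hCα hYb
  exact pasch α hα A hAα B hBα C hCα hn a ha
    (line_subset_plane a ha α hα X Y hXY hXa hYa hXα hYα) hA hBa hCa ⟨X, hXa, hX⟩

/-- The inner form of Pasch's axiom. -/
theorem pasch_inner (hb : b ∈ lines) (hB : B ∈ b) (hC : C ∈ b) (hAb : A ∉ b)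
    (hX : Between A X B) (hY : Between B C Y) : ∃ Z, Between A Z C ∧ Between X Z Y := by
  have hYb : Y ∈ b := hY.mem₃ hb hB hC
  have hXb : X ∉ b := fun h => hAb (hX.mem₁ hb h hB)
  have hXY : X ≠ Y := fun h => hXb (h ▸ hYb)
  obtain ⟨a, ha, hXa, hYa⟩ := exists_line X Y hXY
  have hB' : B ∉ a := fun h => hXb (line_unique hY.ne₁₃ ha hb h hYa hB hYb ▸ hXa)
  have hC' : C ∉ a := fun h => hXb (line_unique hY.ne₂₃ ha hb h hYa hC hYb ▸ hXa)
  have hA' : A ∉ a := fun h => hB' (hX.mem₃ ha h hXa)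
  -- The line `XY` meets the line `BC` only in `Y`, outside the side, so it must leave the triangle
  -- through `AC`.
  have key : ∃ Z ∈ a, Between A Z C := by
    obtain h | ⟨Z, hZa, hZ⟩ := pasch_of_mem_side hb hB hC hYb hAb hY.ne₁₂ hX ha hXa hYa hA' hB' hC'
    · exact h
    · have hZY : Z = Y := by
        by_contra hne
        exact hB' (line_unique hne ha hb hZa hYa (hZ.mem₂ hb hB hC) hYb ▸ hB)
      exact absurd hY (hZY ▸ hZ).symm.not_rotate'
  obtain ⟨Z, hZa, hZ⟩ := key
  refine ⟨Z, hZ, ?_⟩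
  have hAC : A ≠ C := fun h => hAb (h ▸ hC)
  obtain ⟨c, hc, hAc, hCc⟩ := exists_line A C hAC
  have hBc : B ∉ c := fun h => hAb (line_unique hY.ne₁₂ hc hb h hCc hB hC ▸ hAc)
  have hYc : Y ∉ c := fun h => hBc (hY.mem₁ hc hCc h)
  have hXc : X ∉ c := fun h => hBc (hX.mem₃ hc hAc h)
  obtain ⟨d, hd, hAd, hBd⟩ := exists_line A B hX.ne₁₃
  have hXd : X ∈ d := hX.mem₂ hd hAd hBd
  have hYd : Y ∉ d := fun h => hAb (line_unique hY.ne₁₃ hd hb hBd h hB hYb ▸ hAd)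
  -- Pasch again, for triangle `YBX` and the line `AC` entering at `C`: it cannot leave through
  -- `BX`, as it meets that line in the outer point `A`.
  obtain ⟨W, hWc, hW⟩ | ⟨W, hWc, hW⟩ := pasch_of_mem_side (A := Y) (B := B) (C := X) (X := C)
    (Y := A) hd hBd hXd hAd hYd hX.ne₂₃.symm hY.symm hc hCc hAc hYc hBc hXc
  · have hWa : W ∈ a := hW.mem₂ ha hYa hXa
    have : W = Z := by
      by_contra hne
      exact hA' (line_unique hne hc ha hWc (hZ.mem₂ hc hAc hCc) hWa hZa ▸ hAc)
    exact this ▸ hW.symm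
  · have hWd : W ∈ d := hW.mem₂ hd hBd hXd
    have : W = A := by
      by_contra hne
      exact hBc (line_unique hne hc hd hWc hAc hWd hAd ▸ hBd)
    exact absurd (this ▸ hW) hX.not_rotate'

/-- Apply inner Pasch to a triangle `AFC` with `E` inside `AF` and `G` on the extension of `FC`: the
line `EG` cuts `AC`. -/
theorem exists_between (h : A ≠ C) : ∃ B, Between A B C := by
  obtain ⟨l, hl, hA, hC⟩ := exists_line A C h
  obtain ⟨E, hE⟩ := exists_notMem hl
  obtain ⟨F, hF⟩ := between_extend A E (fun h => hE (h ▸ hA))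
  have hFl : F ∉ l := fun h => hE (hF.mem₂ hl hA h)
  have hFC : F ≠ C := fun h => hFl (h ▸ hC)
  obtain ⟨G, hG⟩ := between_extend F C hFC
  obtain ⟨k, hk, hFk, hCk⟩ := exists_line F C hFC
  obtain ⟨B, hB, -⟩ := pasch_inner hk hFk hCk
    (fun hAk => hFl (line_unique h hk hl hAk hCk hA hC ▸ hFk)) hF hG
  exact ⟨B, hB⟩

/-! ### Order of three and four points on a line -/

/-- In triangle `GBC` the line `AD` enters at `D` and meets the line `BC` only in `A`, outside the
side, so it leaves through `GC`. `between_of_not_between` uses this twice, with `A` and `C`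
exchanged. -/
theorem exists_mem_between_of_not_between (ha : a ∈ lines) (hA : A ∈ a) (hB : B ∈ a) (hC : C ∈ a)
    (hAB : A ≠ B) (hAC : A ≠ C) (hBC : B ≠ C) (hD : D ∉ a) (hG : Between G D B)
    (h : ¬ Between B A C) : ∃ b ∈ lines, A ∈ b ∧ D ∈ b ∧ ∃ E ∈ b, Between G E C := by
  have hAD : A ≠ D := fun h => hD (h ▸ hA)
  obtain ⟨m, hm, hAm, hDm⟩ := exists_line A D hAD
  refine ⟨m, hm, hAm, hDm, ?_⟩
  have hBm : B ∉ m := fun h => hAB (eq_of_mem_lines hm ha hDm hD hAm hA h hB)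
  have hCm : C ∉ m := fun h => hAC (eq_of_mem_lines hm ha hDm hD hAm hA h hC)
  have hGm : G ∉ m := fun h => hBm (hG.mem₃ hm h hDm)
  have hGa : G ∉ a := fun h => hD (hG.mem₂ ha h hB)
  obtain h1 | ⟨Z, hZm, hZ⟩ :=
    pasch_of_mem_side ha hB hC hA hGa hBC hG hm hDm hAm hGm hBm hCm
  · exact h1
  · exact absurd (eq_of_mem_lines hm ha hDm hD hAm hA hZm (hZ.mem₂ ha hB hC) ▸ hZ) h

/-- Of three points on a line one lies between the two others. -/
theorem between_of_not_between (ha : a ∈ lines) (hA : A ∈ a) (hB : B ∈ a) (hC : C ∈ a)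
    (hAB : A ≠ B) (hAC : A ≠ C) (hBC : B ≠ C) (h1 : ¬ Between B A C) (h2 : ¬ Between A C B) :
    Between A B C := by
  obtain ⟨D, hD⟩ := exists_notMem ha
  have hBD : B ≠ D := fun h => hD (h ▸ hB)
  obtain ⟨G, hG⟩ := between_extend B D hBD
  have hGa : G ∉ a := fun h => hD (hG.mem₂ ha hB h)
  obtain ⟨m, hm, hAm, hDm, E, hEm, hE⟩ :=
    exists_mem_between_of_not_between ha hA hB hC hAB hAC hBC hD hG.symm h1
  obtain ⟨n, hn, hCn, hDn, F, hFn, hF⟩ :=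
    exists_mem_between_of_not_between ha hC hB hA hBC.symm hAC.symm hAB.symm hD hG.symm
      (fun h => h2 h.symm)
  obtain ⟨k, hk, hGk, hCk⟩ := exists_line G C hE.ne₁₃
  have hEk : E ∈ k := hE.mem₂ hk hGk hCk
  have hBk : B ∉ k := fun h => hBC (eq_of_mem_lines hk ha hGk hGa h hB hCk hC)
  have hDk : D ∉ k := fun h => hBk (hG.mem₁ hk h hGk)
  have hAk : A ∉ k := fun h => hAC (eq_of_mem_lines hk ha hGk hGa h hA hCk hC)
  have hAn : A ∉ n := fun h => hAC (eq_of_mem_lines hn ha hDn hD h hA hCn hC)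
  have hBn : B ∉ n := fun h => hBC (eq_of_mem_lines hn ha hDn hD h hB hCn hC)
  have hCm : C ∉ m := fun h => hAC (eq_of_mem_lines hm ha hDm hD hAm hA h hC)
  have hGn : G ∉ n := fun h => hBn (hG.mem₁ hn hDn h)
  have hEn : E ∉ n := fun h => hDk (eq_of_mem_lines hn hm hCn hCm h hEm hDn hDm ▸ hEk)
  -- Triangle `AGE` and the line `CD` entering at `F`: its point `C` on the line `GE` is outside the
  -- side.
  have hADE : Between A D E := by
    obtain ⟨Z, hZn, hZ⟩ | ⟨Z, hZn, hZ⟩ :=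
      pasch_of_mem_side hk hGk hEk hCk hAk hE.ne₁₂ hF.symm hn hFn hCn hAn hGn hEn
    · exact eq_of_mem_lines hn hm hCn hCm hZn (hZ.mem₂ hm hAm hEm) hDn hDm ▸ hZ
    · have hZC : Z = C := eq_of_mem_lines hn hk hDn hDk hZn (hZ.mem₂ hk hGk hEk) hCn hCk
      exact absurd (hZC ▸ hZ.symm) hE.not_rotate
  obtain ⟨j, hj, hBj, hDj⟩ := exists_line B D hBD
  have hGj : G ∈ j := hG.mem₃ hj hBj hDj
  have hAj : A ∉ j := fun h => hAB (eq_of_mem_lines hj ha hDj hD h hA hBj hB)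
  have hCj : C ∉ j := fun h => hBC (eq_of_mem_lines hj ha hDj hD hBj hB h hC)
  have hEj : E ∉ j := fun h => hE.ne₁₂ (eq_of_mem_lines hj hk hDj hDk hGj hGk h hEk)
  -- Triangle `AEC` and the line `BD` entering at `D`: its point `G` on the line `EC` is outside the
  -- side, so it crosses `AC`, necessarily at `B`.
  obtain ⟨Z, hZj, hZ⟩ | ⟨Z, hZj, hZ⟩ :=
    pasch_of_mem_side hk hEk hCk hGk hAk hE.ne₂₃ hADE hj hDj hGj hAj hEj hCj
  · exact eq_of_mem_lines hj ha hDj hD hZj (hZ.mem₂ ha hA hC) hBj hB ▸ hZ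
  · have hZG : Z = G := eq_of_mem_lines hj hk hDj hDk hZj (hZ.mem₂ hk hEk hCk) hGj hGk
    exact absurd (hZG ▸ hZ) hE.symm.not_rotate

theorem between_trichotomy (ha : a ∈ lines) (hA : A ∈ a) (hB : B ∈ a) (hC : C ∈ a)
    (hAB : A ≠ B) (hAC : A ≠ C) (hBC : B ≠ C) :
    Between A B C ∨ Between B A C ∨ Between A C B := by
  by_contra! h
  exact h.1 (between_of_not_between ha hA hB hC hAB hAC hBC h.2.1 h.2.2)

/-- Two uses of inner Pasch give `H` on the line `CE` inside the side `DG` of triangle `DGA`. That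
line meets the line `GA` only in the outer point `E`, so it crosses `DA`, and it can do so only at
`C`. -/
theorem Between.trans_right (h : Between A B C) (h' : Between B C D) : Between A C D := by
  obtain ⟨l, hl, hA, hB, hC⟩ := between_collinear A B C h
  have hD : D ∈ l := h'.mem₃ hl hB hC
  have hAD : A ≠ D := by
    rintro rfl
    exact h.not_rotate h'
  obtain ⟨E, hE⟩ := exists_notMem hl
  have hCE : C ≠ E := fun h => hE (h ▸ hC)
  obtain ⟨F, hF⟩ := between_extend C E hCE
  obtain ⟨k, hk, hCk, hEk⟩ := exists_line C E hCE
  have hFk : F ∈ k := hF.mem₃ hk hCk hEk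
  have hFl : F ∉ l := fun h => hE (hF.mem₂ hl hC h)
  have hAk : A ∉ k := fun hh => h.ne₁₃ (eq_of_mem_lines hk hl hEk hE hh hA hCk hC)
  have hDk : D ∉ k := fun hh => h'.ne₂₃ (eq_of_mem_lines hk hl hEk hE hCk hC hh hD)
  obtain ⟨G, hG, hG'⟩ := pasch_inner hk hCk hEk hAk h hF
  have hGk : G ∉ k := fun h => hAk (hG.mem₁ hk h hEk)
  obtain ⟨q, hq, hBq, hFq⟩ := exists_line B F hG'.ne₁₃
  have hGq : G ∈ q := hG'.mem₂ hq hBq hFq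
  have hDq : D ∉ q := fun hh => h'.ne₁₃ (eq_of_mem_lines hq hl hFq hFl hBq hB hh hD)
  obtain ⟨H, hH, hH'⟩ := pasch_inner hq hBq hGq hDq h'.symm hG'
  obtain ⟨r, hr, hAr, hEr⟩ := exists_line A E hG.ne₁₃
  have hGr : G ∈ r := hG.mem₂ hr hAr hEr
  have hDr : D ∉ r := fun hh => hAD (eq_of_mem_lines hr hl hEr hE hAr hA hh hD)
  obtain ⟨Z, hZk, hZ⟩ | ⟨Z, hZk, hZ⟩ :=
    pasch_of_mem_side hr hGr hAr hEr hDr hG.ne₁₂.symm hH hk (hH'.mem₂ hk hCk hFk) hEk hDk hGk hAk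
  · exact eq_of_mem_lines hk hl hEk hE hZk (hZ.mem₂ hl hD hA) hCk hC ▸ hZ.symm
  · have hZE : Z = E := eq_of_mem_lines hr hk hAr hAk (hZ.mem₂ hr hGr hAr) hZk hEr hEk
    exact absurd (hZE ▸ hZ) hG.not_rotate

theorem Between.trans_left (h : Between A B C) (h' : Between B C D) : Between A B D :=
  (h'.symm.trans_right h.symm).symm

/-- Otherwise the line `BC` would enter triangle `AXZ` through `XZ` and leave through `AX` or `AZ`,
whose lines it meets only in the outer points `B` and `C`. -/
theorem not_between_of_between_sides (ha : a ∈ lines) (hA : A ∉ a) (hB : B ∈ a) (hC : C ∈ a)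
    (hX : Between A X B) (hY : Between B Y C) (hZ : Between A Z C) : ¬ Between X Y Z := by
  intro h
  obtain ⟨b, hb, hAb, hZb, hCb⟩ := between_collinear A Z C hZ
  obtain ⟨c, hc, hAc, hXc, hBc⟩ := between_collinear A X B hX
  have hXa : X ∉ a := fun h => hA (hX.mem₁ ha h hB)
  have hZa : Z ∉ a := fun h => hA (hZ.mem₁ ha h hC)
  have hBb : B ∉ b := fun h => hY.ne₁₃ (eq_of_mem_lines hb ha hAb hA h hB hCb hC)
  have hXb : X ∉ b := fun h => hBb (hX.mem₃ hb hAb h)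
  obtain ⟨W, hWa, hW⟩ | ⟨W, hWa, hW⟩ := pasch_of_mem_side hb hZb hAb hCb hXb hZ.ne₁₂.symm h ha
    (hY.mem₂ ha hB hC) hC hXa hZa hA
  · have : W = B := eq_of_mem_lines hc ha hAc hA (hW.mem₂ hc hXc hAc) hWa hBc hB
    exact absurd (this ▸ hW) hX.not_rotate
  · have : W = C := eq_of_mem_lines hb ha hAb hA (hW.mem₂ hb hZb hAb) hWa hCb hC
    exact absurd (this ▸ hW) hZ.not_rotate

/-- A line does not meet the interiors of all three sides of a triangle. -/
theorem not_meets_three_sides (ha : a ∈ lines) (hA : A ∉ a) (hB : B ∈ a) (hC : C ∈ a)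
    (hX : Between A X B) (hY : Between B Y C) (hZ : Between A Z C)
    (hb : b ∈ lines) (hXb : X ∈ b) (hYb : Y ∈ b) (hZb : Z ∈ b) : False := by
  obtain ⟨d, hd, hAd, hZd, hCd⟩ := between_collinear A Z C hZ
  obtain ⟨c, hc, hAc, hXc, hBc⟩ := between_collinear A X B hX
  have hXa : X ∉ a := fun h => hA (hX.mem₁ ha h hB)
  have hZa : Z ∉ a := fun h => hA (hZ.mem₁ ha h hC)
  have hYa : Y ∈ a := hY.mem₂ ha hB hC
  have hBd : B ∉ d := fun h => hY.ne₁₃ (eq_of_mem_lines hd ha hAd hA h hB hCd hC)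
  have hCc : C ∉ c := fun h => hY.ne₁₃ (eq_of_mem_lines hc ha hAc hA hBc hB h hC)
  have hXY : X ≠ Y := fun h => hXa (h ▸ hYa)
  have hYZ : Y ≠ Z := fun h => hZa (h ▸ hYa)
  have hXZ : X ≠ Z := fun h => hBd (hX.mem₃ hd hAd (h ▸ hZd))
  obtain h | h | h := between_trichotomy hb hXb hYb hZb hXY hXZ hYZ
  · exact not_between_of_between_sides ha hA hB hC hX hY hZ h
  · exact not_between_of_between_sides hc hCc hAc hBc hZ.symm hX hY.symm h.symm
  · exact not_between_of_between_sides hd hBd hAd hCd hX.symm hZ hY h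

/-- A point cannot lie in the interiors of all three segments joining three points of a line. -/
theorem Between.not_between_of_between (h : Between A C B) (h' : Between B C D) :
    ¬ Between A C D := by
  intro h''
  obtain ⟨l, hl, hA, hC, hB⟩ := between_collinear A C B h
  have hD : D ∈ l := h'.mem₃ hl hB hC
  obtain ⟨G, hG⟩ := exists_notMem hl
  have hBG : B ≠ G := fun h => hG (h ▸ hB)
  obtain ⟨K, hK⟩ := exists_between hBG
  obtain ⟨b, hb, hBb, hKb, hGb⟩ := between_collinear B K G hK
  have hKl : K ∉ l := fun h => hG (hK.mem₃ hl hB h)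
  obtain ⟨m, hm, hCm, hGm⟩ := exists_line C G (fun h => hG (h ▸ hC))
  have hBm : B ∉ m := fun hh => h.ne₂₃ (eq_of_mem_lines hm hl hGm hG hCm hC hh hB)
  have hKm : K ∉ m := fun hh => hBm (hK.mem₁ hm hh hGm)
  -- For `X = A` and `X = D` this makes the line `CG` cross `KA` and `KD`; with `C` inside `AD` it
  -- would meet all three sides of triangle `KAD`.
  have key : ∀ {X : P}, X ∈ l → Between X C B → ∃ Z ∈ m, Between X Z K := by
    intro X hX hXC
    have hXm : X ∉ m := fun hh => hXC.ne₁₂ (eq_of_mem_lines hm hl hGm hG hh hX hCm hC)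
    have hXb : X ∉ b := fun hh => hXC.ne₁₃ (eq_of_mem_lines hb hl hGb hG hh hX hBb hB)
    obtain h1 | ⟨Z, hZm, hZ⟩ :=
      pasch_of_mem_side hb hBb hKb hGb hXb hK.ne₁₂ hXC hm hCm hGm hXm hBm hKm
    · exact h1
    · have hZG : Z = G := eq_of_mem_lines hb hm hBb hBm (hZ.mem₂ hb hBb hKb) hZm hGb hGm
      exact absurd (hZG ▸ hZ) hK.symm.not_rotate'
  obtain ⟨Z, hZm, hZ⟩ := key hA h
  obtain ⟨W, hWm, hW⟩ := key hD h'.symm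
  exact not_meets_three_sides hl hKl hA hD hZ.symm h'' hW.symm hm hZm hCm hWm

/-- The other orders of `A`, `B`, `C` are excluded: most contradict transitivity, and the last would
put `C` inside all of `AB`, `BD` and `AD`. -/
theorem Between.inner_left (h : Between A B D) (h' : Between B C D) : Between A B C := by
  obtain ⟨l, hl, hA, hB, hD⟩ := between_collinear A B D h
  have hC : C ∈ l := h'.mem₂ hl hB hD
  have hAC : A ≠ C := by
    rintro rfl
    exact h.not_rotate' h'.symm
  obtain h1 | h1 | h1 := between_trichotomy hl hA hB hC h.ne₁₂ hAC h'.ne₁₂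
  · exact h1
  · exact absurd (h1.symm.trans_right h).symm h'.not_rotate'
  · obtain h2 | h2 | h2 := between_trichotomy hl hA hC hD hAC h.ne₁₃ h'.ne₂₃
    · exact absurd h2 (h1.not_between_of_between h')
    · exact absurd (h2.symm.trans_left h1) h.not_rotate'
    · exact absurd (h2.trans_left h'.symm) h.symm.not_rotate'

theorem Between.inner_right (h : Between A B D) (h' : Between B C D) : Between A C D :=
  (h.inner_left h').trans_right h'

/-- Two different points on a ray beginning at `A`, on the extension of `[BA]` beyond `A`. -/
theorem Between.of_mem_ray (h : Between B A E) (hX : X ∈ ray A E) (hne : A ≠ X) :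
    Between B A X := by
  obtain rfl | rfl | h1 | h1 := hX
  · exact absurd rfl hne
  · exact h
  · exact h.inner_left h1
  · exact h.trans_left h1

theorem segmentSet_comm (A B : P) : segmentSet A B = segmentSet B A := by
  ext X
  simp only [segmentSet, interval, Set.mem_union, Set.mem_singleton_iff, Set.mem_ofPred_eq]
  have : Between A X B ↔ Between B X A := ⟨Between.symm, Between.symm⟩
  tauto

end OrderedGeometry

/-! ### The semigroup of congruence classes of segments -/

section SegmentClass

variable {P : Type u} [CongruenceGeometry P] {A B C D E O : P}

theorem Segment.of_comm (h : A ≠ B) : Segment.of A B h = Segment.of B A h.symm :=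
  Subtype.ext (segmentSet_comm A B)

theorem eq_of_segCong_of_mem_ray {s : Segment P} (hCE : C ≠ E) (hA : A ∈ ray C E)
    (hB : B ∈ ray C E) (hCA : C ≠ A) (hCB : C ≠ B) (h1 : SegCong s (Segment.of C A hCA))
    (h2 : SegCong s (Segment.of C B hCB)) : A = B :=
  (segment_transfer s C E hCE).unique ⟨hA, hCA, h1⟩ ⟨hB, hCB, h2⟩

/-- Transfer `t` back onto the ray carrying `s = [AB]`: by transitivity `s` is congruent to the
copy, and uniqueness of transfer makes the copy `s` itself. -/
theorem segCong_symm {s t : Segment P} (h : SegCong s t) : SegCong t s := by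
  obtain ⟨_, A, B, hAB, rfl⟩ := s
  obtain ⟨D, ⟨hD, hAD, h'⟩, -⟩ := segment_transfer t A B hAB
  have hBD : B = D := eq_of_segCong_of_mem_ray hAB (.inr (.inl rfl)) hD hAB hAD
    (segCong_refl _) (segCong_trans _ _ _ h h')
  subst hBD
  exact h'

variable (P) in
/-- Congruence of segments is an equivalence relation. -/
instance segmentSetoid : Setoid (Segment P) :=
  ⟨SegCong, segCong_refl, segCong_symm, segCong_trans _ _ _⟩

variable (P) in
/-- The classes of congruent segments. -/
def SegmentClass : Type u := Quotient (segmentSetoid P)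

/-- The class of the segment `s`. -/
def Segment.toClass (s : Segment P) : SegmentClass P := Quotient.mk _ s

theorem Segment.toClass_eq {s t : Segment P} : s.toClass = t.toClass ↔ SegCong s t :=
  Quotient.eq (r := segmentSetoid P)

/-- The class of the segment `[AB]`. -/
def segClass (A B : P) (h : A ≠ B) : SegmentClass P := (Segment.of A B h).toClass

theorem segClass_comm (h : A ≠ B) : segClass A B h = segClass B A h.symm :=
  congrArg Segment.toClass (Segment.of_comm h)

theorem exists_segClass_eq (a : SegmentClass P) : ∃ (A B : P) (h : A ≠ B), segClass A B h = a := by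
  induction a using Quotient.ind with
  | _ s =>
    obtain ⟨_, A, B, hAB, rfl⟩ := s
    exact ⟨A, B, hAB, rfl⟩

theorem exists_mem_ray_segClass_eq (a : SegmentClass P) (h : O ≠ E) :
    ∃ X ∈ ray O E, ∃ hX : O ≠ X, segClass O X hX = a := by
  induction a using Quotient.ind with
  | _ s =>
    obtain ⟨X, ⟨h1, h2, h3⟩, -⟩ := segment_transfer s O E h
    exact ⟨X, h1, h2, (Segment.toClass_eq.2 h3).symm⟩

theorem exists_between_segClass_eq (a : SegmentClass P) (h : A ≠ B) :
    ∃ (C : P) (hC : Between A B C), segClass B C hC.ne₂₃ = a := by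
  obtain ⟨E, hE⟩ := between_extend A B h
  obtain ⟨C, hC, hBC, h'⟩ := exists_mem_ray_segClass_eq a hE.ne₂₃
  exact ⟨C, hE.of_mem_ray hC hBC, h'⟩

theorem segClass_sum_congr {A' B' C' : P} (h : Between A B C) (h' : Between A' B' C')
    (h1 : segClass A B h.ne₁₂ = segClass A' B' h'.ne₁₂)
    (h2 : segClass B C h.ne₂₃ = segClass B' C' h'.ne₂₃) :
    segClass A C h.ne₁₃ = segClass A' C' h'.ne₁₃ :=
  Segment.toClass_eq.2 (segment_sum _ _ _ _ _ _ h h' (Segment.toClass_eq.1 h1)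
    (Segment.toClass_eq.1 h2))

theorem exists_segClass_sum (a b : SegmentClass P) : ∃ c : SegmentClass P,
    ∃ (A B C : P) (h : Between A B C), segClass A B h.ne₁₂ = a ∧ segClass B C h.ne₂₃ = b ∧
      segClass A C h.ne₁₃ = c := by
  obtain ⟨A, B, hAB, rfl⟩ := exists_segClass_eq a
  obtain ⟨C, h, rfl⟩ := exists_between_segClass_eq b hAB
  exact ⟨_, A, B, C, h, rfl, rfl, rfl⟩

noncomputable instance : Add (SegmentClass P) := ⟨fun a b => (exists_segClass_sum a b).choose⟩

theorem segClass_add (h : Between A B C) :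
    segClass A B h.ne₁₂ + segClass B C h.ne₂₃ = segClass A C h.ne₁₃ := by
  obtain ⟨A', B', C', h', h1, h2, h3⟩ :=
    (exists_segClass_sum (segClass A B h.ne₁₂) (segClass B C h.ne₂₃)).choose_spec
  exact h3.symm.trans (segClass_sum_congr h' h h1 h2)

noncomputable instance : AddCommSemigroup (SegmentClass P) where
  add_assoc a b c := by
    obtain ⟨A, B, hAB, rfl⟩ := exists_segClass_eq a
    obtain ⟨C, h, rfl⟩ := exists_between_segClass_eq b hAB
    obtain ⟨D, h', rfl⟩ := exists_between_segClass_eq c h.ne₁₃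
    -- The three segments lie end to end as `A`, `B`, `C`, `D`, so both bracketings equal the class
    -- of `[AD]`.
    have h1 : Between B C D := (h'.symm.inner_left h.symm).symm
    have h2 : Between A B D := (h'.symm.inner_right h.symm).symm
    rw [segClass_add h, segClass_add h', segClass_add h1, segClass_add h2]
  add_comm a b := by
    obtain ⟨A, B, hAB, rfl⟩ := exists_segClass_eq a
    obtain ⟨C, h, rfl⟩ := exists_between_segClass_eq b hAB
    rw [segClass_add h, segClass_comm hAB, segClass_comm h.ne₂₃, segClass_add h.symm,
      segClass_comm]

/-- With both segments laid off on the ray `AB`, the cases in the definition of `ray` are exactly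
the alternatives. -/
theorem segmentClass_total (a b : SegmentClass P) :
    a = b ∨ (∃ c, a + c = b) ∨ ∃ c, b + c = a := by
  obtain ⟨A, B, hAB, rfl⟩ := exists_segClass_eq a
  obtain ⟨D, hD, hAD, rfl⟩ := exists_mem_ray_segClass_eq b hAB
  obtain rfl | rfl | h | h := hD
  · exact absurd rfl hAD
  · exact .inl rfl
  · exact .inr (.inr ⟨_, segClass_add h⟩)
  · exact .inr (.inl ⟨_, segClass_add h⟩)

theorem segmentClass_add_ne (a c : SegmentClass P) : a + c ≠ a := by
  obtain ⟨A, B, hAB, rfl⟩ := exists_segClass_eq a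
  obtain ⟨C, h, rfl⟩ := exists_between_segClass_eq c hAB
  rw [segClass_add h]
  intro hc
  exact h.ne₂₃ (eq_of_segCong_of_mem_ray hAB (.inr (.inl rfl)) (.inr (.inr (.inr h))) hAB h.ne₁₃
    (segCong_refl _) (segCong_symm (Segment.toClass_eq.1 hc)))

/-- The class of a sum of `n` replicas of `e` is the `n`-fold sum of the class of `e`. -/
theorem Segment.IsSumOfReplicas.toClass_eq {t e : Segment P} {n : ℕ}
    (h : t.IsSumOfReplicas n e) (hn : 0 < n) :
    (t.toClass : WithZero (SegmentClass P)) = n • (e.toClass : WithZero (SegmentClass P)) := by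
  obtain ⟨A, ⟨hne, rfl⟩, hcong, hbet⟩ := h
  have hstep (i : ℕ) (hi : i + 1 ≤ n) : ∃ h, segClass (A i) (A (i + 1)) h = e.toClass := by
    obtain ⟨h1, h2⟩ := hcong i hi
    exact ⟨h1, (Segment.toClass_eq.2 h2).symm⟩
  -- The replicas give betweenness of neighbours only; adding the next one to the sum needs it
  -- measured from `A 0`.
  have hbet' (i : ℕ) (hi : i + 2 ≤ n) : Between (A 0) (A (i + 1)) (A (i + 2)) := by
    induction i with
    | zero => exact hbet 0 hi
    | succ i ih => exact (ih (by omega)).trans_right (hbet (i + 1) hi)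
  have key (i : ℕ) (hi : i + 1 ≤ n) : ∃ h, (segClass (A 0) (A (i + 1)) h :
      WithZero (SegmentClass P)) = (i + 1) • (e.toClass : WithZero (SegmentClass P)) := by
    induction i with
    | zero =>
      obtain ⟨h1, h2⟩ := hstep 0 hi
      exact ⟨h1, by simpa using h2⟩
    | succ i ih =>
      obtain ⟨h1, h2⟩ := ih (by omega)
      obtain ⟨h3, h4⟩ := hstep (i + 1) hi
      have hb := hbet' i hi
      refine ⟨hb.ne₁₃, ?_⟩
      rw [succ_nsmul, ← h2, ← h4, ← WithZero.coe_add, segClass_add hb]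
  obtain ⟨m, rfl⟩ := Nat.exists_eq_succ_of_ne_zero hn.ne'
  exact (key m le_rfl).2

theorem Segment.Smaller.exists_add_eq {s t : Segment P} (h : s.Smaller t) :
    ∃ c, s.toClass + c = t.toClass := by
  obtain ⟨C, D, E, h, rfl, h'⟩ := h
  refine ⟨segClass E D h.ne₂₃, ?_⟩
  rw [Segment.toClass_eq.2 h']
  exact segClass_add h

end SegmentClass

/-! ### Archimedean property and the length function -/

theorem segmentClass_archimedean {P : Type u} [AbsoluteGeometry P] (a e : SegmentClass P) :
    ∃ n : ℕ, ∃ c : WithZero (SegmentClass P),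
      (a : WithZero (SegmentClass P)) + c = n • (e : WithZero (SegmentClass P)) := by
  induction a using Quotient.ind with
  | _ s =>
  induction e using Quotient.ind with
  | _ e =>
  obtain ⟨n, hn, t, ht, hst⟩ := AbsoluteGeometry.archimedes s e
  obtain ⟨c, hc⟩ := hst.exists_add_eq
  exact ⟨n, c, by rw [← Segment.toClass, ← Segment.toClass, ← ht.toClass_eq hn, ← hc,
    WithZero.coe_add]⟩

theorem theorem7p4 {P : Type*} [AbsoluteGeometry P] (O E : P) (hOE : O ≠ E) :
    ∃! ξ : Segment P → ℝ, IsLengthFunction (Segment.of O E hOE) ξ := by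
  obtain ⟨f, hpos, hone, hadd⟩ := exists_real_measure segmentClass_total segmentClass_add_ne
    segmentClass_archimedean (segClass O E hOE)
  refine ⟨fun s => f s.toClass, ⟨fun s => hpos _, hone,
    fun s t h => congrArg f (Segment.toClass_eq.2 h), fun A B C h => ?_⟩, fun ξ hξ => ?_⟩
  · exact (congrArg f (segClass_add h).symm).trans (hadd _ _)
  · let g : SegmentClass P → ℝ := Quotient.lift ξ hξ.congruent
    have hg : g = f := by
      refine real_measure_unique segmentClass_total (e := segClass O E hOE) (fun a => ?_)
        hξ.reference (fun a b => ?_) hpos hone hadd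
      · induction a using Quotient.ind with
        | _ s => exact hξ.pos s
      · obtain ⟨A, B, hAB, rfl⟩ := exists_segClass_eq a
        obtain ⟨C, h, rfl⟩ := exists_between_segClass_eq b hAB
        rw [segClass_add h]
        exact hξ.additive A B C h
    funext s
    exact congrFun hg s.toClass
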